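/- Let $A=\{(0,1,1),(1,0,1),(1,1,0),(1,1,1)\}$. An $m\times n$ array of zeros and ones is a partial $\mathcal C(n,2,3,A,1)$ covering array if for any choice of three of its rows each vector of $A$ appears at least once among the columns of these three rows; a set of three rows is called deficient if at least one vector of $A$ does not appear. For $0<\alpha<1$ put $$\beta=\beta(\alpha)=\frac{1-\alpha^2-\sqrt{1-3\alpha^4-6\alpha^2+8\alpha^3}}{2-2\alpha},\qquad \kappa=\kappa(\alpha)=\frac{3\alpha^2+1-2\alpha-\sqrt{1+10\alpha^2-12\alpha^3-4\alpha+5\alpha^4}}{2\alpha},$$ $$\xi(\alpha)=\frac{(1-\alpha)^{3-3\alpha}(1-\beta)^{1-\beta}\alpha^{2\alpha}}{\beta^{\beta}(\alpha-\beta)^{2\alpha-2\beta}(1-2\alpha+\beta)^{1-2\alpha+\beta}(1-\alpha-\beta)^{1-\alpha-\beta}},\qquad \theta(\alpha)=\frac{\alpha^{3\alpha}(1-\alpha)^{2-2\alpha}(1-\kappa)^{1-\kappa}}{\kappa^{\kappa}(\alpha-\kappa)^{3\alpha-3\kappa}(1-2\alpha+\kappa)^{1-2\alpha+\kappa}},$$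 and let $\mu(\alpha)=\xi(\alpha)$ if $\alpha\le 1/2$ and $\mu(\alpha)=\theta(\alpha)$ if $\alpha>1/2$. Theorem 3. There is a constant $K>0$ such that for every rational $\alpha\in(0,1)$ there is a sequence $\varepsilon_n\to0$ for which, with $$\nu_n(\alpha)=\frac{1+\varepsilon_n}{\sqrt K\,\mu(\alpha)^{n/2}\,n^{1/4}},$$ the following holds for every $n$ such that $k=\alpha n$ is a positive integer. (i) For every $m\le\nu_n(\alpha)$, if the rows of an $m\times n$ array are chosen independently, each uniformly among the $\binom nk$ vectors in $\{0,1\}^n$ with exactly $k$ ones, and $X$ is the number of deficient sets of three rows, then $\mathbb P(X=0)>0$. (ii) The largest number of rows of a partial $\mathcal C(n,2,3,A,1)$ covering array all of whose rows have exactly $k=\alpha n$ ones exists and is at least $\nu_n(\alpha)$. -/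

import Mathlib

open Filter Topology MeasureTheory ProbabilityTheory

noncomputable section

/-- Number of columns `j` in which the selected rows `f 0 < f 1 < ... < f (t-1)` of the `m × n`
array `M` show the `t`-tuple `a` (read in the order of the rows). -/
def occurrences {q t m n : ℕ} (M : Fin m → Fin n → Fin q) (f : Fin t ↪o Fin m)
    (a : Fin t → Fin q) : ℕ :=
  (Finset.univ.filter (fun j : Fin n => ∀ i : Fin t, M (f i) j = a i)).card

/-- The `m × n` array `M` is a partial `t`-covering array `C(n, q, t, A, l)`: for any choice of
`t` rows, each `t`-tuple in `A` appears at least `l` times among the columns of those rows. -/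
def IsPartialCoveringArray {q m n : ℕ} (t : ℕ) (A : Set (Fin t → Fin q)) (l : ℕ)
    (M : Fin m → Fin n → Fin q) : Prop :=
  ∀ f : Fin t ↪o Fin m, ∀ a ∈ A, l ≤ occurrences M f a

/-- The ensemble `A = {(0,1,1), (1,0,1), (1,1,0), (1,1,1)}`. -/
def gekrTuples : Set (Fin 3 → Fin 2) :=
  {![0, 1, 1], ![1, 0, 1], ![1, 1, 0], ![1, 1, 1]}

/-- The weight (number of ones) of a 0/1 vector. -/
def weight {n : ℕ} (v : Fin n → Fin 2) : ℕ :=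
  (Finset.univ.filter (fun j : Fin n => v j = 1)).card

/-- A set of three rows `f 0 < f 1 < f 2` is deficient if at least one of the four vectors in
`gekrTuples` is missing among the columns of these rows. -/
def IsDeficient {m n : ℕ} (M : Fin m → Fin n → Fin 2) (f : Fin 3 ↪o Fin m) : Prop :=
  ∃ a ∈ gekrTuples, ∀ j : Fin n, ∃ i : Fin 3, M (f i) j ≠ a i

/-- `X`: the number of deficient sets of three rows. -/
def numDeficient {m n : ℕ} (M : Fin m → Fin n → Fin 2) : ℕ :=
  {f : Fin 3 ↪o Fin m | IsDeficient M f}.ncard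

/-- The uniform distribution on the 0/1 vectors of length `n` and weight `k`. -/
def rowLaw (n k : ℕ) : Measure (Fin n → Fin 2) :=
  uniformOn {v | weight v = k}

/-- The law of the random `m × n` array: independent rows, each uniform among the vectors of
weight `k`. -/
def arrayLaw (m n k : ℕ) : Measure (Fin m → Fin n → Fin 2) :=
  Measure.pi (fun _ : Fin m => rowLaw n k)

/-- `β(α)`. -/
def gekrBeta (α : ℝ) : ℝ :=
  (1 - α ^ 2 - √(1 - 3 * α ^ 4 - 6 * α ^ 2 + 8 * α ^ 3)) / (2 - 2 * α)

/-- `κ(α)`. -/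
def gekrKappa (α : ℝ) : ℝ :=
  (3 * α ^ 2 + 1 - 2 * α - √(1 + 10 * α ^ 2 - 12 * α ^ 3 - 4 * α + 5 * α ^ 4)) / (2 * α)

/-- `ξ(α)`, with real powers. -/
def gekrXi (α : ℝ) : ℝ :=
  let β := gekrBeta α
  ((1 - α) ^ (3 - 3 * α) * (1 - β) ^ (1 - β) * α ^ (2 * α)) /
    (β ^ β * (α - β) ^ (2 * α - 2 * β) * (1 - 2 * α + β) ^ (1 - 2 * α + β) *
      (1 - α - β) ^ (1 - α - β))

/-- `θ(α)`, with real powers. -/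
def gekrTheta (α : ℝ) : ℝ :=
  let κ := gekrKappa α
  (α ^ (3 * α) * (1 - α) ^ (2 - 2 * α) * (1 - κ) ^ (1 - κ)) /
    (κ ^ κ * (α - κ) ^ (3 * α - 3 * κ) * (1 - 2 * α + κ) ^ (1 - 2 * α + κ))

open Classical in
/-- `μ(α)`: `ξ(α)` for `α ≤ 1/2` and `θ(α)` for `α > 1/2`. -/
def gekrMu (α : ℝ) : ℝ :=
  if α ≤ 1 / 2 then gekrXi α else gekrTheta α

/-- `ν_n(α) = (1 + δ) / (√K μ(α)^{n/2} n^{1/4})`, where `δ` is the value at `n` of the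
`o(1)` term. -/
def gekrNu (K α δ : ℝ) (n : ℕ) : ℝ :=
  1 / (√K * gekrMu α ^ ((n : ℝ) / 2) * (n : ℝ) ^ ((1 : ℝ) / 4)) * (1 + δ)

end

/-! ### Alteration: families avoiding bad triples. -/

section Combinatorics

open Finset

/-! This is the alteration method, with a deficiency probability bounded without polynomial loss. If
`p` is the probability that three random rows are deficient, `2 * m` random rows have on average at
most `(2 * m) ^ 3 * p` deficient triples. When this is at most `m`, deleting one row per triple
leaves `m` good rows; so `8 * m ^ 2 * p ≤ 1` suffices. One good array gives (i), since it has
positive mass, and the lower bound in (ii).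

To bound `p`, sum over the overlap `j` of two supports; each summand is a product of three binomial
coefficients. With `x` equal to β or κ, the ratio of consecutive summands near `j = x * n` tends to
1. By this equation each summand times `(α ^ k * (1 - α) ^ (n - k)) ^ 2` is exactly `gekrXi α ^ n`
or `gekrTheta α ^ n` times three binomial masses (`tilt_disjoint`, `tilt_superset`). The first mass
sums to one over `j`; the other two are O(1/√n) uniformly (`exists_binomMass_mul_sqrt_le`), which
gains a factor `n`. Normalizing by the squared binomial coefficient loses the same factor
(`one_le_mul_choose_sq`), so `p ≤ D * gekrMu α ^ n` (`exists_deficient_count_le`). For `m` of order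
ν, `m ^ 2 * p` is then O(1/√n): the factor `n ^ (1/4)` in ν absorbs every constant, which permits `K
= 1` and an error that is eventually zero. -/

/-- Resampling three coordinates: the number of families in `S` whose restriction to three given
places has the property `Q` is at most its expected value. -/
theorem card_filter_comp_mul_le {V ι κ : Type*} [Fintype ι] [DecidableEq ι] [Fintype κ]
    [DecidableEq κ] (S : Finset V) (Q : (κ → V) → Prop) [DecidablePred Q] (f : κ ↪ ι) :
    #{F ∈ Fintype.piFinset (fun _ : ι => S) | Q (F ∘ f)} * #S ^ Fintype.card κ ≤
      #{t ∈ Fintype.piFinset (fun _ : κ => S) | Q t} * #S ^ Fintype.card ι := by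
  classical
  have hι : #S ^ Fintype.card ι = #(Fintype.piFinset fun _ : ι => S) := by
    simp [Fintype.card_piFinset]
  have hκ : #S ^ Fintype.card κ = #(Fintype.piFinset fun _ : κ => S) := by
    simp [Fintype.card_piFinset]
  rw [hι, hκ, ← card_product, ← card_product]
  -- Exchange: the entries of `F` along `f` move to the first component, and `s` takes their places.
  refine card_le_card_of_injOn (fun p => (p.1 ∘ f, Function.extend f p.2 p.1)) ?_ ?_
  · rintro ⟨F, s⟩ h
    simp only [mem_coe, mem_product, mem_filter, Fintype.mem_piFinset] at h ⊢
    refine ⟨⟨fun i => h.1.1 _, h.1.2⟩, fun i => ?_⟩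
    by_cases hi : ∃ a, f a = i
    · obtain ⟨a, rfl⟩ := hi
      rw [f.injective.extend_apply]
      exact h.2 a
    · rw [Function.extend_apply' _ _ _ hi]
      exact h.1.1 i
  · rintro ⟨F, s⟩ - ⟨F', s'⟩ - h
    simp only [Prod.mk.injEq] at h
    have hs : s = s' := by
      rw [← Function.extend_comp f.injective s F, h.2, Function.extend_comp f.injective]
    refine Prod.ext (funext fun i => ?_) hs
    by_cases hi : ∃ a, f a = i
    · obtain ⟨a, rfl⟩ := hi
      exact congrFun h.1 a
    · have := congrFun h.2 i
      rwa [Function.extend_apply' _ _ _ hi, Function.extend_apply' _ _ _ hi] at this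

/-- The alteration method for triples: a random family of `2 m` members of `S`, with one member of
each bad triple deleted, leaves `m` members without a bad triple. -/
theorem exists_family_forall_triple_not {V : Type*} (S : Finset V) (hS : S.Nonempty)
    (Q : (Fin 3 → V) → Prop) [DecidablePred Q] (m : ℕ)
    (h : (2 * m) ^ 3 * #{t ∈ Fintype.piFinset (fun _ : Fin 3 => S) | Q t} ≤ m * #S ^ 3) :
    ∃ F : Fin m → V, (∀ i, F i ∈ S) ∧ ∀ f : Fin 3 ↪o Fin m, ¬ Q (F ∘ f) := by
  classical
  set Ω := Fintype.piFinset (fun _ : Fin (2 * m) => S) with hΩ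
  have hΩne : Ω.Nonempty := Fintype.piFinset_nonempty.2 fun _ => hS
  have hScard : 0 < #S ^ 3 := pow_pos hS.card_pos 3
  have hcard : Fintype.card (Fin 3 ↪o Fin (2 * m)) ≤ (2 * m) ^ 3 := by
    calc Fintype.card (Fin 3 ↪o Fin (2 * m)) ≤ Fintype.card (Fin 3 → Fin (2 * m)) :=
          Fintype.card_le_of_injective (fun f => (f : Fin 3 → Fin (2 * m))) DFunLike.coe_injective
      _ = (2 * m) ^ 3 := by simp
  have hsum : ∑ F ∈ Ω, #{f : Fin 3 ↪o Fin (2 * m) | Q (F ∘ f)} ≤ ∑ F ∈ Ω, m := by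
    have hswap : ∑ F ∈ Ω, #{f : Fin 3 ↪o Fin (2 * m) | Q (F ∘ f)} =
        ∑ f : Fin 3 ↪o Fin (2 * m), #{F ∈ Ω | Q (F ∘ f)} := by
      simp only [card_filter]
      exact sum_comm
    rw [hswap]
    refine Nat.le_of_mul_le_mul_right ?_ hScard
    calc (∑ f : Fin 3 ↪o Fin (2 * m), #{F ∈ Ω | Q (F ∘ f)}) * #S ^ 3
        = ∑ f : Fin 3 ↪o Fin (2 * m), #{F ∈ Ω | Q (F ∘ f)} * #S ^ 3 := sum_mul _ _ _
      _ ≤ ∑ _f : Fin 3 ↪o Fin (2 * m),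
            #{t ∈ Fintype.piFinset (fun _ : Fin 3 => S) | Q t} * #S ^ (2 * m) := by
          refine sum_le_sum fun f _ => ?_
          simpa using card_filter_comp_mul_le S Q f.toEmbedding
      _ = Fintype.card (Fin 3 ↪o Fin (2 * m)) *
            #{t ∈ Fintype.piFinset (fun _ : Fin 3 => S) | Q t} * #S ^ (2 * m) := by
          rw [sum_const, card_univ, smul_eq_mul, mul_assoc]
      _ ≤ m * #S ^ 3 * #S ^ (2 * m) :=
          Nat.mul_le_mul_right _ ((Nat.mul_le_mul_right _ hcard).trans h)
      _ = (∑ F ∈ Ω, m) * #S ^ 3 := by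
          rw [sum_const, hΩ, Fintype.card_piFinset_const, smul_eq_mul]
          ring
  obtain ⟨F, hF, hFm⟩ := exists_le_of_sum_le hΩne hsum
  -- One row of every bad triple; at most `m` rows are lost.
  set R : Finset (Fin (2 * m)) :=
    ({f : Fin 3 ↪o Fin (2 * m) | Q (F ∘ f)} : Finset _).image fun f => f 0 with hR
  have hRc : m ≤ #Rᶜ := by
    have := card_image_le (s := ({f : Fin 3 ↪o Fin (2 * m) | Q (F ∘ f)} : Finset _))
      (f := fun f => f 0)
    rw [card_compl, Fintype.card_fin]
    rw [← hR] at this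
    omega
  refine ⟨F ∘ Rᶜ.orderEmbOfCardLe hRc, fun i => Fintype.mem_piFinset.1 hF _, fun f hf => ?_⟩
  have h0 := Rᶜ.orderEmbOfCardLe_mem hRc (f 0)
  rw [mem_compl] at h0
  -- The increasing enumeration of the surviving rows keeps triples ordered, so a bad triple among
  -- them would be one whose first row was deleted.
  refine h0 (mem_image.2 ⟨f.trans (Rᶜ.orderEmbOfCardLe hRc), ?_, rfl⟩)
  simpa [Function.comp_def] using hf

/-! ### Counting deficient triples of supports. -/

variable {α : Type*} [Fintype α] [DecidableEq α]

theorem card_filter_card_inter_eq_le (A : Finset α) (k j : ℕ) :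
    #{B ∈ powersetCard k (univ : Finset α) | #(A ∩ B) = j} ≤
      (#A).choose j * (Fintype.card α - #A).choose (k - j) := by
  rw [← card_compl, ← card_powersetCard, ← card_powersetCard, ← card_product]
  refine card_le_card_of_injOn (fun B => (A ∩ B, Aᶜ ∩ B)) ?_ ?_
  · intro B hB
    simp only [mem_coe, mem_filter, mem_powersetCard, mem_product] at hB ⊢
    refine ⟨⟨inter_subset_left, hB.2⟩, inter_subset_left, ?_⟩
    have h1 : Aᶜ ∩ B = B \ (A ∩ B) := by ext; simp; tauto
    rw [h1, card_sdiff_of_subset inter_subset_right, hB.2, hB.1.2]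
  · intro B _ B' _ h
    simp only [Prod.mk.injEq] at h
    have key : ∀ C : Finset α, C = A ∩ C ∪ Aᶜ ∩ C := fun C => by ext; simp; tauto
    rw [key B, key B', h.1, h.2]

theorem sum_powersetCard_inter_le (A : Finset α) (k : ℕ) (hA : #A = k) (g : ℕ → ℕ) :
    ∑ B ∈ powersetCard k (univ : Finset α), g #(A ∩ B) ≤
      ∑ j ∈ range (k + 1), k.choose j * (Fintype.card α - k).choose (k - j) * g j := by
  rw [← sum_fiberwise_of_maps_to (t := range (k + 1)) (g := fun B => #(A ∩ B))]
  · refine sum_le_sum fun j _ => ?_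
    rw [sum_congr rfl (g := fun _ => g j) (fun B hB => by rw [(mem_filter.1 hB).2]), sum_const,
      smul_eq_mul]
    have := card_filter_card_inter_eq_le A k j
    rw [hA] at this
    exact Nat.mul_le_mul_right _ this
  · intro B hB
    rw [mem_range, Nat.lt_succ_iff, ← hA]
    exact card_le_card inter_subset_left

theorem card_filter_inter_eq_empty_le (J : Finset α) (k : ℕ) :
    #{C ∈ powersetCard k (univ : Finset α) | J ∩ C = ∅} ≤ (Fintype.card α - #J).choose k := by
  rw [← card_compl, ← card_powersetCard]
  refine card_le_card fun C hC => ?_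
  simp only [mem_filter, mem_powersetCard] at hC ⊢
  refine ⟨fun x hx => mem_compl.2 fun hxJ => ?_, hC.1.2⟩
  have : x ∈ J ∩ C := mem_inter.2 ⟨hxJ, hx⟩
  simp [hC.2] at this

theorem card_filter_superset_le (J : Finset α) (k : ℕ) :
    #{C ∈ powersetCard k (univ : Finset α) | J ⊆ C} ≤
      (Fintype.card α - #J).choose (k - #J) := by
  rw [← card_compl, ← card_powersetCard]
  refine card_le_card_of_injOn (fun C => C \ J) ?_ ?_
  · intro C hC
    simp only [mem_coe, mem_filter, mem_powersetCard] at hC ⊢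
    refine ⟨fun x hx => mem_compl.2 (mem_sdiff.1 hx).2, ?_⟩
    rw [card_sdiff_of_subset hC.2, hC.1.2]
  · intro C hC C' hC' h
    simp only [mem_coe, mem_filter] at hC hC'
    rw [← sdiff_union_of_subset hC.2, ← sdiff_union_of_subset hC'.2]
    exact congrArg (· ∪ J) h

/-- Counts the ways to extend a `k`-set by two further `k`-sets, when `r j` bounds the number of
choices of the last set, given that the first two meet in `j` elements. -/
def tripleCount (n k : ℕ) (r : ℕ → ℕ) : ℕ :=
  ∑ j ∈ range (k + 1), k.choose j * (n - k).choose (k - j) * r j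

theorem card_triples_le (k : ℕ) (P : Finset α → Finset α → Prop) [DecidableRel P]
    (r : ℕ → ℕ)
    (hr : ∀ J, #{C ∈ powersetCard k (univ : Finset α) | P J C} ≤ r #J) :
    #{p ∈ powersetCard k (univ : Finset α) ×ˢ powersetCard k (univ : Finset α) ×ˢ
        powersetCard k (univ : Finset α) | P (p.1 ∩ p.2.1) p.2.2} ≤
      (Fintype.card α).choose k * tripleCount (Fintype.card α) k r := by
  rw [card_filter, sum_product]
  simp only [sum_product]
  calc _ = ∑ A ∈ powersetCard k (univ : Finset α), ∑ B ∈ powersetCard k (univ : Finset α),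
        #{C ∈ powersetCard k (univ : Finset α) | P (A ∩ B) C} := by simp only [card_filter]
    _ ≤ ∑ A ∈ powersetCard k (univ : Finset α), ∑ B ∈ powersetCard k (univ : Finset α),
        r #(A ∩ B) := sum_le_sum fun A _ => sum_le_sum fun B _ => hr _
    _ ≤ ∑ A ∈ powersetCard k (univ : Finset α), tripleCount (Fintype.card α) k r :=
        sum_le_sum fun A hA => sum_powersetCard_inter_le A k (mem_powersetCard.1 hA).2 r
    _ = _ := by simp

/-- The supports of three rows that miss `(1,1,1)`, `(0,1,1)`, `(1,0,1)` or `(1,1,0)`. -/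
def DeficientSupports (t : Fin 3 → Finset α) : Prop :=
  t 0 ∩ t 1 ∩ t 2 = ∅ ∨ t 1 ∩ t 2 ⊆ t 0 ∨ t 0 ∩ t 2 ⊆ t 1 ∨ t 0 ∩ t 1 ⊆ t 2

instance : DecidablePred (DeficientSupports (α := α)) := fun t => by
  unfold DeficientSupports; infer_instance

/-- The permutation selects which support plays the third role, so one estimate serves all three
vectors of weight two. -/
theorem card_triples_perm_le (k : ℕ) (P : Finset α → Finset α → Prop) [DecidableRel P]
    (r : ℕ → ℕ)
    (hr : ∀ J, #{C ∈ powersetCard k (univ : Finset α) | P J C} ≤ r #J)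
    (σ : Equiv.Perm (Fin 3)) :
    #{t ∈ Fintype.piFinset (fun _ : Fin 3 => powersetCard k (univ : Finset α)) |
        P (t (σ 0) ∩ t (σ 1)) (t (σ 2))} ≤
      (Fintype.card α).choose k * tripleCount (Fintype.card α) k r := by
  refine le_trans ?_ (card_triples_le k P r hr)
  refine card_le_card_of_injOn (fun t => (t (σ 0), t (σ 1), t (σ 2))) ?_ ?_
  · intro t ht
    simp only [mem_coe, mem_filter, Fintype.mem_piFinset, mem_product] at ht ⊢
    exact ⟨⟨ht.1 _, ht.1 _, ht.1 _⟩, ht.2⟩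
  · intro t _ t' _ h
    simp only [Prod.mk.injEq] at h
    have : t ∘ σ = t' ∘ σ := by
      funext i
      fin_cases i
      exacts [h.1, h.2.1, h.2.2]
    exact σ.surjective.injective_comp_right this

theorem card_deficientSupports_le (k : ℕ) :
    #{t ∈ Fintype.piFinset (fun _ : Fin 3 => powersetCard k (univ : Finset α)) |
        DeficientSupports t} ≤
      (Fintype.card α).choose k *
        (tripleCount (Fintype.card α) k (fun j => (Fintype.card α - j).choose k) +
          3 * tripleCount (Fintype.card α) k (fun j => (Fintype.card α - j).choose (k - j))) := by
  have h0 : #{t ∈ Fintype.piFinset (fun _ : Fin 3 => powersetCard k (univ : Finset α)) |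
      t 0 ∩ t 1 ∩ t 2 = ∅} ≤ _ := card_triples_perm_le k (fun J C : Finset α => J ∩ C = ∅)
    (fun j => (Fintype.card α - j).choose k)
    (fun J => card_filter_inter_eq_empty_le J k) 1
  have hs : ∀ σ, _ := card_triples_perm_le k (fun J C : Finset α => J ⊆ C)
    (fun j => (Fintype.card α - j).choose (k - j)) (fun J => card_filter_superset_le J k)
  have h1 : #{t ∈ Fintype.piFinset (fun _ : Fin 3 => powersetCard k (univ : Finset α)) |
      t 1 ∩ t 2 ⊆ t 0} ≤ _ := hs (finRotate 3)
  have h2 : #{t ∈ Fintype.piFinset (fun _ : Fin 3 => powersetCard k (univ : Finset α)) |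
      t 0 ∩ t 2 ⊆ t 1} ≤ _ := hs (Equiv.swap 1 2)
  have h3 : #{t ∈ Fintype.piFinset (fun _ : Fin 3 => powersetCard k (univ : Finset α)) |
      t 0 ∩ t 1 ⊆ t 2} ≤ _ := hs 1
  have hor : ∀ (T : Finset (Fin 3 → Finset α)) (p q : (Fin 3 → Finset α) → Prop)
      [DecidablePred p] [DecidablePred q], #{t ∈ T | p t ∨ q t} ≤ #{t ∈ T | p t} + #{t ∈ T | q t} :=
    fun T p q _ _ => by rw [filter_or]; exact card_union_le _ _
  unfold DeficientSupports
  refine (hor _ _ _).trans ?_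
  refine (add_le_add h0 ((hor _ _ _).trans (add_le_add h1 ((hor _ _ _).trans
    (add_le_add h2 h3))))).trans_eq ?_
  ring

/-- Unimodality and symmetry: `a` is at least as far from `N / 2` as `b`, and `b` is reflected when
it lies beyond the middle. -/
theorem Nat.choose_le_choose_of_add_le {N a b : ℕ} (hab : a ≤ b) (h : a + b ≤ N) :
    N.choose a ≤ N.choose b := by
  have mono : ∀ c, a ≤ c → 2 * c ≤ N → N.choose a ≤ N.choose c := by
    intro c hc
    induction c, hc using Nat.le_induction with
    | base => exact fun _ => le_rfl
    | succ c hc ih =>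
      exact fun h2 => (ih (by omega)).trans (Nat.choose_le_succ_of_lt_half_left (by omega))
  by_cases hb : 2 * b ≤ N
  · exact mono b hab hb
  · rw [← Nat.choose_symm (show b ≤ N by omega)]
    exact mono _ (by omega) (by omega)

theorem tripleCount_mono {n k : ℕ} {r s : ℕ → ℕ} (h : ∀ j ≤ k, r j ≤ s j) :
    tripleCount n k r ≤ tripleCount n k s :=
  sum_le_sum fun j hj => Nat.mul_le_mul_left _ (h j (Nat.lt_succ_iff.1 (mem_range.1 hj)))

theorem tripleCount_superset_le_disjoint {n k : ℕ} (h : 2 * k ≤ n) :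
    tripleCount n k (fun j => (n - j).choose (k - j)) ≤
      tripleCount n k (fun j => (n - j).choose k) :=
  tripleCount_mono fun j hj => Nat.choose_le_choose_of_add_le (by omega) (by omega)

theorem tripleCount_disjoint_le_superset {n k : ℕ} (h : n ≤ 2 * k) :
    tripleCount n k (fun j => (n - j).choose k) ≤
      tripleCount n k (fun j => (n - j).choose (k - j)) := by
  refine tripleCount_mono fun j hj => ?_
  by_cases hk : k ≤ n - j
  -- After reflection the lower indices are `n - j - k ≤ k - j`, with sum `n - 2 * j`.
  · rw [← Nat.choose_symm hk]
    exact Nat.choose_le_choose_of_add_le (by omega) (by omega)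
  · rw [Nat.choose_eq_zero_of_lt (by omega)]
    exact Nat.zero_le _

end Combinatorics

/-! ### From supports to arrays, and finiteness of the maximum. -/

section Arrays

theorem deficientSupports_of_isDeficient {m n : ℕ} {M : Fin m → Fin n → Fin 2}
    {f : Fin 3 ↪o Fin m} (h : IsDeficient M f) :
    DeficientSupports ((fun i => Finset.univ.filter fun j => M i j = 1) ∘ f) := by
  have two : ∀ x : Fin 2, x = 0 ∨ x = 1 := by decide
  obtain ⟨a, ha, h⟩ := h
  simp only [gekrTuples, Set.mem_insert_iff, Set.mem_singleton_iff] at ha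
  simp only [DeficientSupports, Finset.subset_iff, Finset.eq_empty_iff_forall_notMem,
    Finset.mem_inter, Finset.mem_filter, Finset.mem_univ, true_and, Function.comp]
  simp only [Fin.exists_fin_succ, IsEmpty.exists_iff, or_false] at h
  rcases ha with rfl | rfl | rfl | rfl <;> simp at h
  · right; left; intro j hj; have := h j; grind
  · right; right; left; intro j hj; have := h j; grind
  · right; right; right; intro j hj; have := h j; grind
  · left; intro j hj; have := h j; grind

theorem numDeficient_eq_zero_iff {m n : ℕ} {M : Fin m → Fin n → Fin 2} :
    numDeficient M = 0 ↔ ∀ f : Fin 3 ↪o Fin m, ¬ IsDeficient M f := by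
  rw [numDeficient, Set.ncard_eq_zero (Set.toFinite _), Set.eq_empty_iff_forall_notMem]
  rfl

theorem isPartialCoveringArray_of_not_isDeficient {m n : ℕ} {M : Fin m → Fin n → Fin 2}
    (h : ∀ f : Fin 3 ↪o Fin m, ¬ IsDeficient M f) :
    IsPartialCoveringArray 3 gekrTuples 1 M := by
  intro f a ha
  by_contra hlt
  refine h f ⟨a, ha, fun j => ?_⟩
  have h0 : occurrences M f a = 0 := by omega
  rw [occurrences, Finset.card_eq_zero, Finset.filter_eq_empty_iff] at h0
  simpa using h0 (Finset.mem_univ j)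

theorem exists_array_of_card_le {n k m : ℕ} (hk : k ≤ n)
    (h : 8 * m ^ 2 *
        (tripleCount n k (fun j => (n - j).choose k) +
          3 * tripleCount n k (fun j => (n - j).choose (k - j))) ≤ n.choose k ^ 2) :
    ∃ M : Fin m → Fin n → Fin 2, (∀ i, weight (M i) = k) ∧
      ∀ f : Fin 3 ↪o Fin m, ¬ IsDeficient M f := by
  have hne : (Finset.powersetCard k (Finset.univ : Finset (Fin n))).Nonempty :=
    Finset.powersetCard_nonempty.2 (by simpa using hk)
  obtain ⟨F, hF, hQ⟩ := exists_family_forall_triple_not _ hne DeficientSupports m (by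
    have := card_deficientSupports_le (α := Fin n) k
    rw [Fintype.card_fin] at this
    rw [Finset.card_powersetCard, Finset.card_univ, Fintype.card_fin]
    refine (Nat.mul_le_mul_left _ this).trans ?_
    calc _ = m * n.choose k * (8 * m ^ 2 *
        (tripleCount n k (fun j => (n - j).choose k) +
          3 * tripleCount n k (fun j => (n - j).choose (k - j)))) := by ring
      _ ≤ m * n.choose k * n.choose k ^ 2 := Nat.mul_le_mul_left _ h
      _ = _ := by ring)
  have hsupp : ∀ i, (Finset.univ.filter fun j => (if j ∈ F i then 1 else 0 : Fin 2) = 1) = F i := by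
    intro i; ext j; simp
  refine ⟨fun i j => if j ∈ F i then 1 else 0, fun i => ?_, fun f hf => ?_⟩
  · rw [weight, hsupp]
    exact (Finset.mem_powersetCard.1 (hF i)).2
  · have := deficientSupports_of_isDeficient hf
    simp only [hsupp] at this
    exact hQ f this

theorem arrayLaw_pos {m n k : ℕ} {M : Fin m → Fin n → Fin 2} (hM : ∀ i, weight (M i) = k)
    (E : Set (Fin m → Fin n → Fin 2)) (hE : M ∈ E) : 0 < arrayLaw m n k E := by
  have hpos : ∀ i, 0 < rowLaw n k {M i} := fun i => by
    rw [pos_iff_ne_zero, rowLaw, Ne, uniformOn_eq_zero_iff (Set.toFinite _)]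
    exact (Set.nonempty_iff_ne_empty.1 ⟨M i, hM i, rfl⟩)
  refine lt_of_lt_of_le ?_ (measure_mono (Set.singleton_subset_iff.2 hE))
  rw [arrayLaw]
  -- A row `M i` is what shows that `rowLaw n k` is a probability measure; the empty array is
  -- treated apart.
  by_cases hm : Nonempty (Fin m)
  · obtain ⟨i⟩ := hm
    have : IsProbabilityMeasure (rowLaw n k) :=
      isProbabilityMeasure_uniformOn (Set.toFinite _) ⟨M i, hM i⟩
    rw [Measure.pi_singleton]
    exact CanonicallyOrderedAdd.prod_pos.2 fun i _ => hpos i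
  · have : IsEmpty (Fin m) := not_nonempty_iff.1 hm
    rw [Measure.pi_of_empty _ M]
    simp

/-- Any two positions of a triple are separated by some vector of `gekrTuples`, which two equal
rows, completed by a third, would miss. -/
theorem rows_injective_of_isPartialCoveringArray {m n : ℕ} (hm : 3 ≤ m)
    {M : Fin m → Fin n → Fin 2} (hM : IsPartialCoveringArray 3 gekrTuples 1 M) :
    Function.Injective M := by
  intro i i' hii
  by_contra hne
  obtain ⟨s, hs, hcard⟩ := Finset.exists_subsuperset_card_eq (s := {i, i'}) (t := Finset.univ)
    (n := 3) (Finset.subset_univ _) (by rw [Finset.card_pair hne]; omega) (by simpa using hm)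
  set f := s.orderEmbOfFin hcard.2 with hf
  have hmem : ∀ x ∈ s, ∃ a, f a = x := fun x hx => by
    have : x ∈ Set.range f := by rw [hf, Finset.range_orderEmbOfFin]; exact hx
    exact this
  obtain ⟨a, ha⟩ := hmem i (hs (by simp))
  obtain ⟨b, hb⟩ := hmem i' (hs (by simp))
  have hab : a ≠ b := by rintro rfl; exact hne (ha.symm.trans hb)
  have key : ∀ a b : Fin 3, a ≠ b → ∃ v ∈ gekrTuples, v a ≠ v b := by
    intro a b hab
    by_cases ha : a = 0 ∨ b = 0
    · refine ⟨![0, 1, 1], by simp [gekrTuples], ?_⟩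
      revert a b; decide
    · refine ⟨![1, 0, 1], by simp [gekrTuples], ?_⟩
      revert a b; decide
  obtain ⟨v, hv, hvab⟩ := key a b hab
  have h1 := hM f v hv
  obtain ⟨j, hj⟩ := Finset.card_pos.1 (Nat.lt_of_lt_of_le Nat.zero_lt_one h1)
  have hj := (Finset.mem_filter.1 hj).2
  exact hvab (by rw [← hj a, ← hj b, ha, hb, hii])

/-- Needed only for the maximum to exist; the summand 2 covers arrays too small to contain a triple.
-/
theorem isPartialCoveringArray_card_le {m n : ℕ} {M : Fin m → Fin n → Fin 2}
    (hM : IsPartialCoveringArray 3 gekrTuples 1 M) : m ≤ 2 ^ n + 2 := by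
  by_cases hm : 3 ≤ m
  · have := Fintype.card_le_of_injective M (rows_injective_of_isPartialCoveringArray hm hM)
    simp only [Fintype.card_fin, Fintype.card_pi, Finset.prod_const, Finset.card_univ] at this
    omega
  · exact (by omega : m ≤ 2).trans (Nat.le_add_left _ _)

end Arrays

/-! ### Local bounds for binomial masses. -/

section BinomialMass

open Real

/-- The Stirling sequence decreases from its first value `exp 1 / √2`. -/
theorem factorial_le_exp_mul_sqrt {n : ℕ} (hn : n ≠ 0) :
    (n.factorial : ℝ) ≤ exp 1 * √n * (n / exp 1) ^ n := by
  obtain ⟨m, rfl⟩ := Nat.exists_eq_succ_of_ne_zero hn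
  have h := Stirling.stirlingSeq'_antitone (Nat.zero_le m)
  simp only [Function.comp, Nat.succ_eq_add_one, zero_add, Stirling.stirlingSeq_one] at h
  rw [Stirling.stirlingSeq, div_le_iff₀ (by positivity)] at h
  refine h.trans (le_of_eq ?_)
  rw [Real.sqrt_mul (by norm_num)]
  have : √(2 : ℝ) ≠ 0 := by positivity
  field_simp

/-- The probability of `a` successes in `N` independent trials of success probability `x`. -/
noncomputable def binomMass (x : ℝ) (N a : ℕ) : ℝ := N.choose a * x ^ a * (1 - x) ^ (N - a)

theorem binomMass_nonneg {x : ℝ} (h0 : 0 ≤ x) (h1 : x ≤ 1) (N a : ℕ) : 0 ≤ binomMass x N a := by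
  have : 0 ≤ 1 - x := by linarith
  unfold binomMass; positivity

theorem sum_binomMass (x : ℝ) (N : ℕ) : ∑ a ∈ Finset.range (N + 1), binomMass x N a = 1 := by
  have h := add_pow x (1 - x) N
  rw [add_sub_cancel, one_pow] at h
  rw [h]
  exact Finset.sum_congr rfl fun a _ => by unfold binomMass; ring

theorem binomMass_le_one {x : ℝ} (h0 : 0 ≤ x) (h1 : x ≤ 1) (N a : ℕ) : binomMass x N a ≤ 1 := by
  by_cases ha : a ≤ N
  · rw [← sum_binomMass x N]
    exact Finset.single_le_sum (fun i _ => binomMass_nonneg h0 h1 N i)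
      (Finset.mem_range.2 (Nat.lt_succ_of_le ha))
  · simp [binomMass, Nat.choose_eq_zero_of_lt (not_le.1 ha)]

/-- From `1 + t ≤ exp t`, each factor satisfies `y ^ c ≤ c ^ c * exp (y - c)`, and the two exponents
cancel. -/
theorem pow_mul_pow_le_pow_mul_pow {a b : ℕ} (ha : a ≠ 0) (hb : b ≠ 0) {x : ℝ} (h0 : 0 ≤ x)
    (h1 : x ≤ 1) :
    ((a + b : ℝ) * x) ^ a * ((a + b : ℝ) * (1 - x)) ^ b ≤ (a : ℝ) ^ a * (b : ℝ) ^ b := by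
  have ha' : (0 : ℝ) < a := by positivity
  have hb' : (0 : ℝ) < b := by positivity
  have aux : ∀ (c : ℕ) (y : ℝ), 0 < (c : ℝ) → 0 ≤ y → y ^ c ≤ (c : ℝ) ^ c * exp (y - c) := by
    intro c y hc hy
    have h := Real.add_one_le_exp (y / c - 1)
    rw [sub_add_cancel] at h
    have h2 := pow_le_pow_left₀ (by positivity) h c
    rw [div_pow, div_le_iff₀ (by positivity), ← Real.exp_nat_mul] at h2
    refine h2.trans (le_of_eq ?_)
    rw [mul_comm, mul_sub, mul_div_cancel₀ _ hc.ne', mul_one]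
  have h1' : 0 ≤ 1 - x := by linarith
  have e : ((a + b : ℝ) * x - a) + ((a + b : ℝ) * (1 - x) - b) = 0 := by ring
  calc _ ≤ ((a : ℝ) ^ a * exp ((a + b : ℝ) * x - a)) *
        ((b : ℝ) ^ b * exp ((a + b : ℝ) * (1 - x) - b)) :=
        mul_le_mul (aux a _ ha' (by positivity)) (aux b _ hb' (by positivity)) (by positivity)
          (by positivity)
    _ = (a : ℝ) ^ a * (b : ℝ) ^ b *
        exp (((a + b : ℝ) * x - a) + ((a + b : ℝ) * (1 - x) - b)) := by rw [Real.exp_add]; ring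
    _ = _ := by rw [e, Real.exp_zero, mul_one]

/-- Stirling bounds the binomial coefficient; the powers of `x` and `1 - x` are largest at `x = a /
(a + b)`, where they cancel its exponential part. -/
theorem binomMass_add_mul_le {a b : ℕ} (ha : a ≠ 0) (hb : b ≠ 0) {x : ℝ} (h0 : 0 ≤ x)
    (h1 : x ≤ 1) :
    binomMass x (a + b) a * (√a * √b) ≤ exp 1 * √(a + b) := by
  have h1' : 0 ≤ 1 - x := by linarith
  have hfac : ((a + b).choose a : ℝ) * a.factorial * b.factorial = (a + b).factorial := by
    have := Nat.choose_mul_factorial_mul_factorial (Nat.le_add_right a b)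
    rw [Nat.add_sub_cancel_left] at this
    exact_mod_cast this
  have sq1 : ∀ c : ℕ, √(c : ℝ) * (c / exp 1) ^ c ≤ c.factorial := fun c => by
    refine le_trans ?_ (Stirling.le_factorial_stirling c)
    gcongr
    have : (0 : ℝ) ≤ c := by positivity
    nlinarith [Real.pi_gt_three]
  have hN := factorial_le_exp_mul_sqrt (n := a + b) (by omega)
  push_cast at hN
  have hG := pow_mul_pow_le_pow_mul_pow ha hb h0 h1
  set e := exp 1 with he
  have hepos : 0 < e := Real.exp_pos 1
  have ha' : (0 : ℝ) < a := by positivity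
  have hb' : (0 : ℝ) < b := by positivity
  set P : ℝ := (a / e) ^ a * (b / e) ^ b with hP
  have hPpos : 0 < P := by positivity
  refine le_of_mul_le_mul_right ?_ hPpos
  calc binomMass x (a + b) a * (√a * √b) * P
      = binomMass x (a + b) a * ((√a * (a / e) ^ a) * (√b * (b / e) ^ b)) := by rw [hP]; ring
    _ ≤ binomMass x (a + b) a * (a.factorial * b.factorial) :=
        mul_le_mul_of_nonneg_left (mul_le_mul (sq1 a) (sq1 b) (by positivity) (by positivity))
          (binomMass_nonneg h0 h1 _ _)
    _ = (a + b).factorial * (x ^ a * (1 - x) ^ b) := by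
        rw [← hfac, binomMass, Nat.add_sub_cancel_left]; ring
    _ ≤ e * √(a + b) * ((a + b) / e) ^ (a + b) * (x ^ a * (1 - x) ^ b) :=
        mul_le_mul_of_nonneg_right hN (by positivity)
    _ = e * √(a + b) * ((((a + b : ℝ) * x) ^ a * ((a + b : ℝ) * (1 - x)) ^ b) / e ^ (a + b)) := by
        rw [mul_pow, mul_pow, div_pow, pow_add (a + b : ℝ)]; ring
    _ ≤ e * √(a + b) * (((a : ℝ) ^ a * (b : ℝ) ^ b) / e ^ (a + b)) := by gcongr
    _ = e * √(a + b) * P := by rw [hP, div_pow, div_pow, pow_add]; field_simp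

theorem binomMass_lower {a b : ℕ} (ha : a ≠ 0) (hb : b ≠ 0) {x : ℝ}
    (hx : (a : ℝ) = x * (a + b)) :
    1 ≤ exp 1 ^ 2 * √(a + b) * binomMass x (a + b) a := by
  have ha' : (0 : ℝ) < a := by positivity
  have hb' : (0 : ℝ) < b := by positivity
  have hb1 : (b : ℝ) = (1 - x) * (a + b) := by linarith
  have hfac : ((a + b).choose a : ℝ) * a.factorial * b.factorial = (a + b).factorial := by
    have := Nat.choose_mul_factorial_mul_factorial (Nat.le_add_right a b)
    rw [Nat.add_sub_cancel_left] at this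
    exact_mod_cast this
  have hlow : √(a + b : ℝ) * ((a + b) / exp 1) ^ (a + b) ≤ (a + b).factorial := by
    have := Stirling.le_factorial_stirling (a + b)
    push_cast at this
    refine le_trans ?_ this
    gcongr
    nlinarith [Real.pi_gt_three]
  have hua := factorial_le_exp_mul_sqrt ha
  have hub := factorial_le_exp_mul_sqrt hb
  set e := exp 1 with he
  have hepos : 0 < e := Real.exp_pos 1
  set P : ℝ := (a / e) ^ a * (b / e) ^ b with hP
  have hPpos : 0 < P := by positivity
  have hPeq : P = ((a + b) / e) ^ (a + b) * (x ^ a * (1 - x) ^ b) := by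
    rw [hP, div_pow, div_pow, div_pow, pow_add (a + b : ℝ), pow_add e]
    have hA : (a : ℝ) ^ a = x ^ a * (a + b) ^ a := by rw [← mul_pow, ← hx]
    have hB : (b : ℝ) ^ b = (1 - x) ^ b * (a + b) ^ b := by rw [← mul_pow, ← hb1]
    rw [hA, hB]
    field_simp
  have hspos : 0 < √(a + b : ℝ) := by positivity
  have hx0 : 0 ≤ x := by
    by_contra h
    nlinarith
  have hx1 : 0 ≤ 1 - x := by
    by_contra h
    nlinarith
  have hsq : √(a : ℝ) * √b ≤ √(a + b) * √(a + b) := by gcongr <;> linarith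
  refine le_of_mul_le_mul_right ?_ (mul_pos hPpos hspos)
  calc 1 * (P * √(a + b)) = √(a + b) * ((a + b) / e) ^ (a + b) * (x ^ a * (1 - x) ^ b) := by
        rw [hPeq]; ring
    _ ≤ (a + b).factorial * (x ^ a * (1 - x) ^ b) := by gcongr
    _ = binomMass x (a + b) a * (a.factorial * b.factorial) := by
        rw [← hfac, binomMass, Nat.add_sub_cancel_left]; ring
    _ ≤ binomMass x (a + b) a * ((e * √a * (a / e) ^ a) * (e * √b * (b / e) ^ b)) :=
        mul_le_mul_of_nonneg_left (mul_le_mul hua hub (by positivity) (by positivity))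
          (binomMass_nonneg hx0 (by linarith) _ _)
    _ = binomMass x (a + b) a * (e ^ 2 * P) * (√a * √b) := by rw [hP]; ring
    _ ≤ binomMass x (a + b) a * (e ^ 2 * P) * (√(a + b) * √(a + b)) :=
        mul_le_mul_of_nonneg_left hsq
          (mul_nonneg (binomMass_nonneg hx0 (by linarith) _ _) (by positivity))
    _ = _ := by ring

/-- A mode of the binomial distribution lies within distance one of its mean. -/
theorem exists_binomMass_max {x : ℝ} (h0 : 0 < x) (h1 : x < 1) (N : ℕ) :
    ∃ a b, a + b = N ∧ N * x ≤ a + 1 ∧ N * (1 - x) ≤ b + 1 ∧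
      ∀ l, binomMass x N l ≤ binomMass x N a := by
  have h1' : 0 < 1 - x := by linarith
  obtain ⟨a, ha, hmax⟩ := Finset.exists_max_image (Finset.range (N + 1)) (binomMass x N)
    ⟨0, by simp⟩
  obtain ⟨b, rfl⟩ := Nat.exists_eq_add_of_le (Nat.lt_succ_iff.1 (Finset.mem_range.1 ha))
  have hCpos : (0 : ℝ) < (a + b).choose a := by exact_mod_cast Nat.choose_pos (by omega)
  -- Maximality against the next value `a + 1`; `hdown` uses the previous one.
  have hup : (b : ℝ) * x ≤ (a + 1) * (1 - x) := by
    rcases b with _ | b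
    · simp only [Nat.cast_zero, zero_mul]; positivity
    have hm := hmax (a + 1) (Finset.mem_range.2 (by omega))
    have hc := Nat.choose_succ_right_eq (a + (b + 1)) a
    rw [Nat.add_sub_cancel_left] at hc
    have hc' : ((a + (b + 1)).choose (a + 1) : ℝ) * (a + 1) =
      (a + (b + 1)).choose a * (b + 1 : ℕ) := by exact_mod_cast hc
    rw [binomMass, binomMass, show a + (b + 1) - (a + 1) = b by omega, Nat.add_sub_cancel_left,
      pow_succ, pow_succ] at hm
    have hpos : 0 < x ^ a * (1 - x) ^ b := by positivity
    have hm' : ((a + (b + 1)).choose (a + 1) : ℝ) * x ≤ (a + (b + 1)).choose a * (1 - x) := by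
      refine le_of_mul_le_mul_right ?_ hpos
      linarith
    refine le_of_mul_le_mul_left ?_ hCpos
    nlinarith
  have hdown : (a : ℝ) * (1 - x) ≤ (b + 1) * x := by
    rcases a with _ | a
    · simp only [Nat.cast_zero, zero_mul]; positivity
    have hm := hmax a (Finset.mem_range.2 (by omega))
    have hc := Nat.choose_succ_right_eq (a + 1 + b) a
    rw [show a + 1 + b - a = b + 1 by omega] at hc
    have hc' : ((a + 1 + b).choose (a + 1) : ℝ) * (a + 1 : ℕ) =
      (a + 1 + b).choose a * (b + 1) := by exact_mod_cast hc
    rw [binomMass, binomMass, show a + 1 + b - a = b + 1 by omega, Nat.add_sub_cancel_left,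
      pow_succ, pow_succ] at hm
    have hpos : 0 < x ^ a * (1 - x) ^ b := by positivity
    have hm' : ((a + 1 + b).choose a : ℝ) * (1 - x) ≤ (a + 1 + b).choose (a + 1) * x := by
      refine le_of_mul_le_mul_right ?_ hpos
      linarith
    refine le_of_mul_le_mul_left ?_ hCpos
    nlinarith
  refine ⟨a, b, rfl, ?_, ?_, fun l => ?_⟩
  · push_cast; nlinarith
  · push_cast; nlinarith
  · by_cases hl : l ≤ a + b
    · exact hmax l (Finset.mem_range.2 (Nat.lt_succ_of_le hl))
    · rw [binomMass, Nat.choose_eq_zero_of_lt (not_le.1 hl), Nat.cast_zero, zero_mul, zero_mul]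
      exact binomMass_nonneg h0.le h1.le _ _

/-- The Stirling bound degenerates for `l` near 0 or `N`, so `l` is replaced by the mode, where
successes and failures both number at least `N * y / 2` once `N * y > 2`. Smaller `N` are covered by
the trivial bound 1. -/
theorem exists_binomMass_mul_sqrt_le {x : ℝ} (h0 : 0 < x) (h1 : x < 1) :
    ∃ C : ℝ, 0 < C ∧ ∀ N l : ℕ, binomMass x N l * √N ≤ C := by
  have h1' : 0 < 1 - x := by linarith
  set y := x * (1 - x) with hy
  have hypos : 0 < y := by positivity
  refine ⟨max (√(2 / y)) (2 * exp 1 / y), lt_max_of_lt_left (by positivity), fun N l => ?_⟩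
  rcases le_or_gt (N : ℝ) (2 / y) with hN | hN
  · refine le_max_of_le_left ?_
    calc binomMass x N l * √N ≤ 1 * √N :=
          mul_le_mul_of_nonneg_right (binomMass_le_one h0.le h1.le _ _) (Real.sqrt_nonneg _)
      _ ≤ _ := by rw [one_mul]; exact Real.sqrt_le_sqrt hN
  refine le_max_of_le_right ?_
  have hNy : 2 < N * y := by rwa [div_lt_iff₀ hypos] at hN
  have hNpos : (0 : ℝ) < N := lt_trans (by positivity) hN
  obtain ⟨a, b, rfl, ha, hb, hmax⟩ := exists_binomMass_max h0 h1 N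
  push_cast at ha hb hNy hNpos ⊢
  have hyx : y ≤ x := by rw [hy]; nlinarith
  have hyx' : y ≤ 1 - x := by rw [hy]; nlinarith
  have ha1 : ((a + b : ℝ)) * y / 2 ≤ a := by nlinarith
  have hb1 : ((a + b : ℝ)) * y / 2 ≤ b := by nlinarith
  have hapos : (0 : ℝ) < a := by linarith
  have hbpos : (0 : ℝ) < b := by linarith
  have key := binomMass_add_mul_le (a := a) (b := b) (by exact_mod_cast hapos.ne')
    (by exact_mod_cast hbpos.ne') h0.le h1.le
  have hs : ((a + b : ℝ)) * y / 2 ≤ √a * √b := by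
    rw [← Real.sqrt_mul hapos.le]
    refine Real.le_sqrt_of_sq_le ?_
    rw [sq]
    exact mul_le_mul ha1 hb1 (by positivity) hapos.le
  have hsqrt : (0 : ℝ) < √(a + b) := by positivity
  have hM := binomMass_nonneg h0.le h1.le (a + b) a
  refine (mul_le_mul_of_nonneg_right (hmax l) hsqrt.le).trans ?_
  rw [le_div_iff₀ hypos]
  refine le_of_mul_le_mul_right ?_ hsqrt
  have hss : √(a + b : ℝ) * √(a + b) = a + b := Real.mul_self_sqrt hNpos.le
  calc binomMass x (a + b) a * √(a + b) * y * √(a + b)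
      = 2 * (binomMass x (a + b) a * ((√(a + b : ℝ) * √(a + b)) * y / 2)) := by ring
    _ ≤ 2 * (binomMass x (a + b) a * (√a * √b)) := by rw [hss]; gcongr
    _ ≤ 2 * (exp 1 * √(a + b)) := by gcongr
    _ = _ := by ring

end BinomialMass

/-! ### Stationary overlap, exponential tilt and the rate. -/

section ExponentialRate

open Real

/-- With `0 < a`, a change from positive at `z` to negative at `y > z` isolates the smaller root. -/
theorem smaller_root_facts {a b c y z : ℝ} (ha : 0 < a) (hz : 0 < a * z ^ 2 - b * z + c)
    (hy : a * y ^ 2 - b * y + c < 0) (hzy : z < y) :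
    a * ((b - √(b ^ 2 - 4 * a * c)) / (2 * a)) ^ 2 - b * ((b - √(b ^ 2 - 4 * a * c)) / (2 * a)) + c
      = 0 ∧ z < (b - √(b ^ 2 - 4 * a * c)) / (2 * a) ∧
      (b - √(b ^ 2 - 4 * a * c)) / (2 * a) < y := by
  have hD : 0 < b ^ 2 - 4 * a * c := by nlinarith [sq_nonneg (2 * a * y - b)]
  set s := √(b ^ 2 - 4 * a * c) with hs
  have hspos : 0 < s := Real.sqrt_pos.2 hD
  have hss : s ^ 2 = b ^ 2 - 4 * a * c := Real.sq_sqrt hD.le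
  have h1 : (2 * a * y - b) ^ 2 < s ^ 2 := by rw [hss]; nlinarith
  have h2 : s ^ 2 < (2 * a * z - b) ^ 2 := by rw [hss]; nlinarith
  obtain ⟨h3, h4⟩ := abs_lt_of_sq_lt_sq' h1 hspos.le
  refine ⟨?_, ?_, ?_⟩
  · field_simp
    linear_combination hss
  · rw [lt_div_iff₀ (by positivity)]
    by_contra hcon
    have : 2 * a * z < 2 * a * y := by gcongr
    nlinarith
  · rw [div_lt_iff₀ (by positivity)]
    linarith

/-- The cubic terms of the stationarity equation cancel, leaving the quadratic whose smaller root is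
β. -/
theorem gekrBeta_facts {α : ℝ} (h0 : 0 < α) (h1 : α ≤ 1 / 2) :
    0 < gekrBeta α ∧ gekrBeta α < α ∧
      gekrBeta α * (1 - 2 * α + gekrBeta α) * (1 - gekrBeta α) =
        (α - gekrBeta α) ^ 2 * (1 - α - gekrBeta α) := by
  have h := smaller_root_facts (a := 1 - α) (b := 1 - α ^ 2) (c := α ^ 2 * (1 - α)) (y := α)
    (z := 0) (by linarith) (by
      have : 0 < α ^ 2 * (1 - α) := mul_pos (by positivity) (by linarith)
      linarith) (by
      have : 0 < α * (1 - α) ^ 2 := mul_pos h0 (pow_pos (by linarith) 2)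
      nlinarith) h0
  have e : gekrBeta α = (1 - α ^ 2 - √((1 - α ^ 2) ^ 2 - 4 * (1 - α) * (α ^ 2 * (1 - α)))) /
      (2 * (1 - α)) := by
    rw [gekrBeta]; congr 1
    · congr 2; ring
    · ring
  rw [← e] at h
  obtain ⟨hr, hz, hy⟩ := h
  exact ⟨hz, hy, by linear_combination -hr⟩

theorem gekrKappa_facts {α : ℝ} (h0 : 0 < α) (h1 : α < 1) :
    0 < gekrKappa α ∧ gekrKappa α < α ∧ 0 < 1 - 2 * α + gekrKappa α ∧
      gekrKappa α * (1 - 2 * α + gekrKappa α) * (1 - gekrKappa α) =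
        (α - gekrKappa α) ^ 3 := by
  have hα : α * α ^ 2 - (3 * α ^ 2 + 1 - 2 * α) * α + α ^ 3 < 0 := by
    have : 0 < α * (1 - α) ^ 2 := mul_pos h0 (pow_pos (by linarith) 2)
    nlinarith
  have e : gekrKappa α = (3 * α ^ 2 + 1 - 2 * α -
      √((3 * α ^ 2 + 1 - 2 * α) ^ 2 - 4 * α * α ^ 3)) / (2 * α) := by
    rw [gekrKappa]; congr 3; ring
  have hA := smaller_root_facts (a := α) (b := 3 * α ^ 2 + 1 - 2 * α) (c := α ^ 3) (y := α)
    (z := 0) h0 (by have : 0 < α ^ 3 := by positivity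
                    linarith) hα h0
  -- The quadratic equals `(1 - α) ^ 3` at `2 * α - 1`, so κ also exceeds this point; positivity of
  -- κ is not enough when `α > 1 / 2`.
  have hB := smaller_root_facts (a := α) (b := 3 * α ^ 2 + 1 - 2 * α) (c := α ^ 3) (y := α)
    (z := 2 * α - 1) h0 (by have : 0 < (1 - α) ^ 3 := pow_pos (by linarith) 3
                            nlinarith) hα (by linarith)
  rw [← e] at hA hB
  obtain ⟨hr, hz, hy⟩ := hA
  exact ⟨hz, hy, by linarith [hB.2.1], by linear_combination -hr⟩

theorem rpow_eq_exp_mul_log {x : ℝ} (hx : 0 < x) (y : ℝ) : x ^ y = exp (y * log x) := by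
  rw [Real.rpow_def_of_pos hx, mul_comm]

theorem gekrXi_eq_exp {α x : ℝ} (hx : gekrBeta α = x) (h0 : 0 < x) (h1 : x < α)
    (h2 : 0 < 1 - 2 * α + x) (h3 : 0 < 1 - α - x) :
    gekrXi α = exp ((3 - 3 * α) * log (1 - α) + (1 - x) * log (1 - x) + 2 * α * log α -
      (x * log x + (2 * α - 2 * x) * log (α - x) + (1 - 2 * α + x) * log (1 - 2 * α + x) +
        (1 - α - x) * log (1 - α - x))) := by
  have i1 : 0 < 1 - α := by linarith
  have i2 : 0 < 1 - x := by linarith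
  have i3 : 0 < α := by linarith
  have i4 : 0 < α - x := by linarith
  simp only [gekrXi, hx]
  rw [rpow_eq_exp_mul_log i1, rpow_eq_exp_mul_log i2, rpow_eq_exp_mul_log i3,
    rpow_eq_exp_mul_log h0, rpow_eq_exp_mul_log i4, rpow_eq_exp_mul_log h2,
    rpow_eq_exp_mul_log h3]
  simp only [← Real.exp_add, ← Real.exp_sub]

theorem gekrTheta_eq_exp {α x : ℝ} (hx : gekrKappa α = x) (h0 : 0 < x) (h1 : x < α)
    (h2 : 0 < 1 - 2 * α + x) (h3 : 0 < 1 - α) :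
    gekrTheta α = exp (3 * α * log α + (2 - 2 * α) * log (1 - α) + (1 - x) * log (1 - x) -
      (x * log x + (3 * α - 3 * x) * log (α - x) +
        (1 - 2 * α + x) * log (1 - 2 * α + x))) := by
  have i2 : 0 < 1 - x := by linarith
  have i3 : 0 < α := by linarith
  have i4 : 0 < α - x := by linarith
  simp only [gekrTheta, hx]
  rw [rpow_eq_exp_mul_log h3, rpow_eq_exp_mul_log i2, rpow_eq_exp_mul_log i3,
    rpow_eq_exp_mul_log h0, rpow_eq_exp_mul_log i4, rpow_eq_exp_mul_log h2]
  simp only [← Real.exp_add, ← Real.exp_sub]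

theorem div_pow_eq_exp {x y : ℝ} (hx : 0 < x) (hy : 0 < y) (a : ℕ) :
    (x / y) ^ a = exp (a * (log x - log y)) := by
  rw [← Real.log_div hx.ne' hy.ne', Real.exp_nat_mul, Real.exp_log (div_pos hx hy)]

theorem pow_eq_exp_mul_log {x : ℝ} (hx : 0 < x) (a : ℕ) : x ^ a = exp (a * log x) := by
  rw [Real.exp_nat_mul, Real.exp_log hx]

/-- The exponential tilt that makes the number of common ones of two rows typical does not depend
on that number: rows missing `(1,1,1)`. -/
theorem tilt_disjoint {α x : ℝ} (hx : gekrBeta α = x) (h0 : 0 < x) (h1 : x < α)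
    (h2 : 0 < 1 - 2 * α + x) (h3 : 0 < 1 - α - x)
    (hst : x * (1 - 2 * α + x) * (1 - x) = (α - x) ^ 2 * (1 - α - x))
    {j b c d : ℕ} (hd : j + d = b + c) (hk : ((j + b : ℕ) : ℝ) = α * (j + b + (b + c) : ℕ)) :
    (x / α) ^ j * ((α - x) / α) ^ b * (((α - x) / (1 - α)) ^ b * ((1 - 2 * α + x) / (1 - α)) ^ c) *
      ((α / (1 - x)) ^ (j + b) * ((1 - α - x) / (1 - x)) ^ d) * gekrXi α ^ (j + b + (b + c)) =
    (α ^ (j + b) * (1 - α) ^ (b + c)) ^ 2 := by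
  have i1 : 0 < 1 - α := by linarith
  have i2 : 0 < 1 - x := by linarith
  have i3 : 0 < α := by linarith
  have i4 : 0 < α - x := by linarith
  have hL := congrArg log hst
  rw [Real.log_mul (by positivity) (by positivity), Real.log_mul (by positivity) (by positivity),
    Real.log_mul (by positivity) (by positivity), Real.log_pow] at hL
  rw [gekrXi_eq_exp hx h0 h1 h2 h3, div_pow_eq_exp h0 i3, div_pow_eq_exp i4 i3,
    div_pow_eq_exp i4 i1, div_pow_eq_exp h2 i1, div_pow_eq_exp i3 i2, div_pow_eq_exp h3 i2,
    pow_eq_exp_mul_log i3, pow_eq_exp_mul_log i1, ← Real.exp_nat_mul]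
  simp only [← Real.exp_add]
  rw [← Real.exp_nat_mul]
  congr 1
  have hd' : (d : ℝ) = b + c - j := by
    have : (j : ℝ) + d = b + c := by exact_mod_cast hd
    linarith
  push_cast at hk hL ⊢
  rw [hd']
  generalize log x = X at *
  generalize log α = A at *
  generalize log (1 - α) = A' at *
  generalize log (α - x) = B at *
  generalize log (1 - 2 * α + x) = G at *
  generalize log (1 - x) = E at *
  generalize log (1 - α - x) = H at *
  -- The log of the left side is affine in `j`, with slope zero by stationarity; the first
  -- coefficient is the deviation of `j` from `x * n`. The second uses `k = α * n`.
  linear_combination (j - x * (j + b + (b + c))) * hL +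
    (-2 * A + 2 * B + 3 * A' - 2 * G - H) * hk

/-- The exponential tilt that makes the number of common ones of two rows typical does not depend
on that number: rows missing `(0,1,1)`. -/
theorem tilt_superset {α x : ℝ} (hx : gekrKappa α = x) (h0 : 0 < x) (h1 : x < α)
    (h2 : 0 < 1 - 2 * α + x) (i1 : 0 < 1 - α)
    (hst : x * (1 - 2 * α + x) * (1 - x) = (α - x) ^ 3)
    {j b c : ℕ} (hk : ((j + b : ℕ) : ℝ) = α * (j + b + (b + c) : ℕ)) :
    (x / α) ^ j * ((α - x) / α) ^ b * (((α - x) / (1 - α)) ^ b * ((1 - 2 * α + x) / (1 - α)) ^ c) *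
      (((α - x) / (1 - x)) ^ b * ((1 - α) / (1 - x)) ^ (b + c)) *
        gekrTheta α ^ (j + b + (b + c)) =
    (α ^ (j + b) * (1 - α) ^ (b + c)) ^ 2 := by
  have i2 : 0 < 1 - x := by linarith
  have i3 : 0 < α := by linarith
  have i4 : 0 < α - x := by linarith
  have hL := congrArg log hst
  rw [Real.log_mul (by positivity) (by positivity), Real.log_mul (by positivity) (by positivity),
    Real.log_pow] at hL
  rw [gekrTheta_eq_exp hx h0 h1 h2 i1, div_pow_eq_exp h0 i3, div_pow_eq_exp i4 i3,
    div_pow_eq_exp i4 i1, div_pow_eq_exp h2 i1, div_pow_eq_exp i4 i2, div_pow_eq_exp i1 i2,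
    pow_eq_exp_mul_log i3, pow_eq_exp_mul_log i1, ← Real.exp_nat_mul]
  simp only [← Real.exp_add]
  rw [← Real.exp_nat_mul]
  congr 1
  push_cast at hk hL ⊢
  generalize log x = X at *
  generalize log α = A at *
  generalize log (1 - α) = A' at *
  generalize log (α - x) = B at *
  generalize log (1 - 2 * α + x) = G at *
  generalize log (1 - x) = E at *
  linear_combination (j - x * (j + b + (b + c))) * hL +
    (-3 * A + 3 * B + 2 * A' - 2 * G) * hk

/-- The masses in `j` act as probability weights, so a bound uniform in `j` survives summation
without a factor `k + 1`. -/
theorem tripleCount_mul_le {n k : ℕ} {r : ℕ → ℕ} {p w D : ℝ} (hp0 : 0 ≤ p) (hp1 : p ≤ 1)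
    (hD : 0 ≤ D)
    (h : ∀ j b c : ℕ, k = j + b → n - k = b + c →
      (k.choose j * (n - k).choose (k - j) * r j : ℝ) * w ≤ binomMass p k j * D) :
    (tripleCount n k r : ℝ) * w ≤ D := by
  unfold tripleCount
  push_cast
  rw [Finset.sum_mul]
  calc _ ≤ ∑ j ∈ Finset.range (k + 1), binomMass p k j * D := by
        refine Finset.sum_le_sum fun j hj => ?_
        obtain ⟨b, rfl⟩ := Nat.exists_eq_add_of_le (Nat.lt_succ_iff.1 (Finset.mem_range.1 hj))
        by_cases hb : b ≤ n - (j + b)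
        · obtain ⟨c, hc⟩ := Nat.exists_eq_add_of_le hb
          exact h j b c rfl hc
        · rw [Nat.add_sub_cancel_left, Nat.choose_eq_zero_of_lt (not_le.1 hb)]
          simpa using mul_nonneg (binomMass_nonneg hp0 hp1 _ _) hD
    _ = D := by rw [← Finset.sum_mul, sum_binomMass, one_mul]

theorem exists_tripleCount_disjoint_mul_le {α : ℝ} (h0 : 0 < α) (h1 : α ≤ 1 / 2) :
    ∃ D : ℝ, 0 < D ∧ ∀ n k : ℕ, (k : ℝ) = α * n →
      (tripleCount n k (fun j => (n - j).choose k) : ℝ) * (α ^ k * (1 - α) ^ (n - k)) ^ 2 * n ≤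
        D * gekrXi α ^ n := by
  obtain ⟨hx0, hx1, hst⟩ := gekrBeta_facts h0 h1
  obtain ⟨x, hx⟩ : ∃ x, gekrBeta α = x := ⟨_, rfl⟩
  rw [hx] at hx0 hx1 hst
  have i1 : 0 < 1 - α := by linarith
  have i2 : 0 < 1 - x := by linarith
  have i3 : 0 < 1 - 2 * α + x := by linarith
  have i4 : 0 < α - x := by linarith
  have i5 : 0 < 1 - α - x := by linarith
  have hξ : 0 < gekrXi α := by rw [gekrXi_eq_exp hx hx0 hx1 i3 i5]; exact Real.exp_pos _
  obtain ⟨C, hC, hCle⟩ := exists_binomMass_mul_sqrt_le (x := (α - x) / (1 - α)) (by positivity)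
    (by rw [div_lt_one i1]; linarith)
  obtain ⟨C', hC', hCle'⟩ := exists_binomMass_mul_sqrt_le (x := α / (1 - x)) (by positivity)
    (by rw [div_lt_one i2]; linarith)
  refine ⟨C * C' / (1 - α), by positivity, fun n k hk => ?_⟩
  rcases Nat.eq_zero_or_pos n with rfl | hn
  · simp; positivity
  have hn' : (0 : ℝ) < n := by exact_mod_cast hn
  have hkn : k ≤ n := by
    have : (k : ℝ) ≤ n := by rw [hk]; nlinarith
    exact_mod_cast this
  have hnk : ((n - k : ℕ) : ℝ) = (1 - α) * n := by rw [Nat.cast_sub hkn, hk]; ring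
  have e1 : 1 - x / α = (α - x) / α := by field_simp
  have e2 : 1 - (α - x) / (1 - α) = (1 - 2 * α + x) / (1 - α) := by field_simp; ring
  have e3 : 1 - α / (1 - x) = (1 - α - x) / (1 - x) := by field_simp; ring
  have key := tripleCount_mul_le (n := n) (k := k) (r := fun j => (n - j).choose k) (p := x / α)
    (w := (α ^ k * (1 - α) ^ (n - k)) ^ 2 * (n : ℝ)) (D := C * C' / (1 - α) * gekrXi α ^ n)
    (by positivity) (by rw [div_le_one h0]; exact hx1.le) (by positivity) ?_
  · rwa [← mul_assoc] at key
  intro j b c hkj hc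
  have hpm : 0 ≤ binomMass (x / α) k j :=
    binomMass_nonneg (by positivity) (by rw [div_le_one h0]; exact hx1.le) _ _
  by_cases hkd : k ≤ n - j
  swap
  · rw [Nat.choose_eq_zero_of_lt (not_le.1 hkd), Nat.cast_zero, mul_zero, zero_mul]
    positivity
  obtain ⟨d, hd⟩ := Nat.exists_eq_add_of_le hkd
  have hnj : n = k + (b + c) := by omega
  have hjd : j + d = b + c := by omega
  have ht := tilt_disjoint hx hx0 hx1 i3 i5 hst hjd (by rw [← hkj, ← hnj]; exact hk)
  rw [← hkj, ← hnj, ← hc] at ht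
  have hq := hCle (n - k) b
  have hr := hCle' (n - j) k
  -- Both sample sizes are at least `n - k = (1 - α) * n`, so the two square roots supply a full
  -- factor `n`.
  have hsq : ((1 - α) * n : ℝ) ≤ √((n - k : ℕ) : ℝ) * √((n - j : ℕ) : ℝ) := by
    rw [← hnk]
    refine (Real.mul_self_sqrt (Nat.cast_nonneg (n - k))).symm.le.trans ?_
    gcongr
    omega
  have hmq : 0 ≤ binomMass ((α - x) / (1 - α)) (n - k) b :=
    binomMass_nonneg (by positivity) (by rw [div_le_one i1]; linarith) _ _
  have hmr : 0 ≤ binomMass (α / (1 - x)) (n - j) k :=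
    binomMass_nonneg (by positivity) (by rw [div_le_one i2]; linarith) _ _
  have hkj' : k - j = b := by omega
  have hc' : n - k - b = c := by omega
  have hd' : n - j - k = d := by omega
  have hprod : (k.choose j * (n - k).choose (k - j) * (n - j).choose k : ℝ) *
      (α ^ k * (1 - α) ^ (n - k)) ^ 2 = binomMass (x / α) k j *
        (binomMass ((α - x) / (1 - α)) (n - k) b * binomMass (α / (1 - x)) (n - j) k) *
          gekrXi α ^ n := by
    rw [← ht, binomMass, binomMass, binomMass, e1, e2, e3, hkj', hc', hd']
    ring
  have hqr : binomMass ((α - x) / (1 - α)) (n - k) b * binomMass (α / (1 - x)) (n - j) k * n ≤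
      C * C' / (1 - α) := by
    rw [le_div_iff₀ i1]
    calc _ = binomMass ((α - x) / (1 - α)) (n - k) b * binomMass (α / (1 - x)) (n - j) k *
          ((1 - α) * n) := by ring
      _ ≤ binomMass ((α - x) / (1 - α)) (n - k) b * binomMass (α / (1 - x)) (n - j) k *
          (√((n - k : ℕ) : ℝ) * √((n - j : ℕ) : ℝ)) := by gcongr
      _ = (binomMass ((α - x) / (1 - α)) (n - k) b * √((n - k : ℕ) : ℝ)) *
          (binomMass (α / (1 - x)) (n - j) k * √((n - j : ℕ) : ℝ)) := by ring
      _ ≤ C * C' := mul_le_mul hq hr (by positivity) hC.le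
  calc _ = (k.choose j * (n - k).choose (k - j) * (n - j).choose k : ℝ) *
      (α ^ k * (1 - α) ^ (n - k)) ^ 2 * n := by ring
    _ = binomMass (x / α) k j * ((binomMass ((α - x) / (1 - α)) (n - k) b *
        binomMass (α / (1 - x)) (n - j) k * n) * gekrXi α ^ n) := by rw [hprod]; ring
    _ ≤ _ := by gcongr

theorem exists_tripleCount_superset_mul_le {α : ℝ} (h0 : 0 < α) (h1 : α < 1) :
    ∃ D : ℝ, 0 < D ∧ ∀ n k : ℕ, (k : ℝ) = α * n →
      (tripleCount n k (fun j => (n - j).choose (k - j)) : ℝ) *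
        (α ^ k * (1 - α) ^ (n - k)) ^ 2 * n ≤ D * gekrTheta α ^ n := by
  obtain ⟨hx0, hx1, i3, hst⟩ := gekrKappa_facts h0 h1
  obtain ⟨x, hx⟩ : ∃ x, gekrKappa α = x := ⟨_, rfl⟩
  rw [hx] at hx0 hx1 hst i3
  have i1 : 0 < 1 - α := by linarith
  have i2 : 0 < 1 - x := by linarith
  have i4 : 0 < α - x := by linarith
  have hθ : 0 < gekrTheta α := by rw [gekrTheta_eq_exp hx hx0 hx1 i3 i1]; exact Real.exp_pos _
  obtain ⟨C, hC, hCle⟩ := exists_binomMass_mul_sqrt_le (x := (α - x) / (1 - α)) (by positivity)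
    (by rw [div_lt_one i1]; linarith)
  -- The third row contains the overlap, so it has `k - j` further ones among `n - j` places.
  obtain ⟨C', hC', hCle'⟩ := exists_binomMass_mul_sqrt_le (x := (α - x) / (1 - x)) (by positivity)
    (by rw [div_lt_one i2]; linarith)
  refine ⟨C * C' / (1 - α), by positivity, fun n k hk => ?_⟩
  rcases Nat.eq_zero_or_pos n with rfl | hn
  · simp; positivity
  have hn' : (0 : ℝ) < n := by exact_mod_cast hn
  have hkn : k ≤ n := by
    have : (k : ℝ) ≤ n := by rw [hk]; nlinarith
    exact_mod_cast this
  have hnk : ((n - k : ℕ) : ℝ) = (1 - α) * n := by rw [Nat.cast_sub hkn, hk]; ring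
  have e1 : 1 - x / α = (α - x) / α := by field_simp
  have e2 : 1 - (α - x) / (1 - α) = (1 - 2 * α + x) / (1 - α) := by field_simp; ring
  have e3 : 1 - (α - x) / (1 - x) = (1 - α) / (1 - x) := by field_simp; ring
  have key := tripleCount_mul_le (n := n) (k := k) (r := fun j => (n - j).choose (k - j))
    (p := x / α)
    (w := (α ^ k * (1 - α) ^ (n - k)) ^ 2 * (n : ℝ)) (D := C * C' / (1 - α) * gekrTheta α ^ n)
    (by positivity) (by rw [div_le_one h0]; exact hx1.le) (by positivity) ?_
  · rwa [← mul_assoc] at key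
  intro j b c hkj hc
  have hpm : 0 ≤ binomMass (x / α) k j :=
    binomMass_nonneg (by positivity) (by rw [div_le_one h0]; exact hx1.le) _ _
  have hnj : n = k + (b + c) := by omega
  have ht := tilt_superset hx hx0 hx1 i3 i1 hst (j := j) (b := b) (c := c)
    (by rw [← hkj, ← hnj]; exact hk)
  rw [← hkj, ← hnj, ← hc] at ht
  have hq := hCle (n - k) b
  have hr := hCle' (n - j) b
  have hsq : ((1 - α) * n : ℝ) ≤ √((n - k : ℕ) : ℝ) * √((n - j : ℕ) : ℝ) := by
    rw [← hnk]
    refine (Real.mul_self_sqrt (Nat.cast_nonneg (n - k))).symm.le.trans ?_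
    gcongr
    omega
  have hmq : 0 ≤ binomMass ((α - x) / (1 - α)) (n - k) b :=
    binomMass_nonneg (by positivity) (by rw [div_le_one i1]; linarith) _ _
  have hmr : 0 ≤ binomMass ((α - x) / (1 - x)) (n - j) b :=
    binomMass_nonneg (by positivity) (by rw [div_le_one i2]; linarith) _ _
  have hkj' : k - j = b := by omega
  have hc' : n - k - b = c := by omega
  have hd' : n - j - b = n - k := by omega
  have hprod : (k.choose j * (n - k).choose (k - j) * (n - j).choose (k - j) : ℝ) *
      (α ^ k * (1 - α) ^ (n - k)) ^ 2 = binomMass (x / α) k j *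
        (binomMass ((α - x) / (1 - α)) (n - k) b * binomMass ((α - x) / (1 - x)) (n - j) b) *
          gekrTheta α ^ n := by
    rw [← ht, binomMass, binomMass, binomMass, e1, e2, e3, hkj', hc', hd']
    ring
  have hqr : binomMass ((α - x) / (1 - α)) (n - k) b *
      binomMass ((α - x) / (1 - x)) (n - j) b * n ≤ C * C' / (1 - α) := by
    rw [le_div_iff₀ i1]
    calc _ = binomMass ((α - x) / (1 - α)) (n - k) b * binomMass ((α - x) / (1 - x)) (n - j) b *
          ((1 - α) * n) := by ring
      _ ≤ binomMass ((α - x) / (1 - α)) (n - k) b * binomMass ((α - x) / (1 - x)) (n - j) b *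
          (√((n - k : ℕ) : ℝ) * √((n - j : ℕ) : ℝ)) := by gcongr
      _ = (binomMass ((α - x) / (1 - α)) (n - k) b * √((n - k : ℕ) : ℝ)) *
          (binomMass ((α - x) / (1 - x)) (n - j) b * √((n - j : ℕ) : ℝ)) := by ring
      _ ≤ C * C' := mul_le_mul hq hr (by positivity) hC.le
  calc _ = (k.choose j * (n - k).choose (k - j) * (n - j).choose (k - j) : ℝ) *
      (α ^ k * (1 - α) ^ (n - k)) ^ 2 * n := by ring
    _ = binomMass (x / α) k j * ((binomMass ((α - x) / (1 - α)) (n - k) b *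
        binomMass ((α - x) / (1 - x)) (n - j) b * n) * gekrTheta α ^ n) := by rw [hprod]; ring
    _ ≤ _ := by gcongr

end ExponentialRate

/-! ### Deficiency probability and the choice of constants. -/

section Main

open Real

theorem gekrMu_pos {α : ℝ} (h0 : 0 < α) (h1 : α < 1) : 0 < gekrMu α := by
  unfold gekrMu
  split_ifs with h
  · obtain ⟨hx0, hx1, -⟩ := gekrBeta_facts h0 h
    rw [gekrXi_eq_exp rfl hx0 hx1 (by linarith) (by linarith)]
    exact Real.exp_pos _
  · obtain ⟨hx0, hx1, hx2, -⟩ := gekrKappa_facts h0 h1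
    rw [gekrTheta_eq_exp rfl hx0 hx1 hx2 (by linarith)]
    exact Real.exp_pos _

/-- The square of the Stirling lower bound at the mean. -/
theorem one_le_mul_choose_sq {α : ℝ} (h1 : α < 1) {n k : ℕ} (hk : 0 < k) (hkn : (k : ℝ) = α * n) :
    1 ≤ exp 1 ^ 4 * n * ((n.choose k : ℝ) ^ 2 * (α ^ k * (1 - α) ^ (n - k)) ^ 2) := by
  have hn : (0 : ℝ) < n := by
    rcases Nat.eq_zero_or_pos n with rfl | hn
    · have : (0 : ℝ) < k := by exact_mod_cast hk
      simp at hkn; linarith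
    · exact_mod_cast hn
  have hlt : k < n := by
    have : (k : ℝ) < n := by rw [hkn]; nlinarith
    exact_mod_cast this
  obtain ⟨b, rfl⟩ := Nat.exists_eq_add_of_le hlt.le
  have h := binomMass_lower (a := k) (b := b) (x := α) hk.ne' (by omega)
    (by rw [← Nat.cast_add]; exact hkn)
  have h2 := one_le_pow₀ (n := 2) h
  rw [binomMass, mul_pow, mul_pow, mul_pow, Real.sq_sqrt (by positivity)] at h2
  push_cast
  refine h2.trans (le_of_eq ?_)
  ring

theorem exists_deficient_count_le {α : ℝ} (h0 : 0 < α) (h1 : α < 1) :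
    ∃ D : ℝ, 0 < D ∧ ∀ n k : ℕ, 0 < k → (k : ℝ) = α * n →
      ((tripleCount n k (fun j => (n - j).choose k) +
        3 * tripleCount n k (fun j => (n - j).choose (k - j)) : ℕ) : ℝ) ≤
          D * gekrMu α ^ n * (n.choose k : ℝ) ^ 2 := by
  obtain ⟨D, hD, hle⟩ : ∃ D : ℝ, 0 < D ∧ ∀ n k : ℕ, (k : ℝ) = α * n →
      ((tripleCount n k (fun j => (n - j).choose k) +
        3 * tripleCount n k (fun j => (n - j).choose (k - j)) : ℕ) : ℝ) *
          (α ^ k * (1 - α) ^ (n - k)) ^ 2 * n ≤ D * gekrMu α ^ n := by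
    -- Four forbidden patterns, each counted by at most the dominant `T`, which depends on the side
    -- of `1 / 2`.
    have bound : ∀ (T₁ T₂ T : ℕ) (w n' D μ : ℝ), 0 ≤ w → 0 ≤ n' → T₁ ≤ T → T₂ ≤ T →
        T * w ^ 2 * n' ≤ D * μ → ((T₁ + 3 * T₂ : ℕ) : ℝ) * w ^ 2 * n' ≤ 4 * D * μ := by
      intro T₁ T₂ T w n' D μ hw hn' h₁ h₂ h
      have : ((T₁ + 3 * T₂ : ℕ) : ℝ) ≤ 4 * T := by exact_mod_cast (by omega)
      calc ((T₁ + 3 * T₂ : ℕ) : ℝ) * w ^ 2 * n' ≤ 4 * T * w ^ 2 * n' := by gcongr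
        _ = 4 * (T * w ^ 2 * n') := by ring
        _ ≤ 4 * (D * μ) := by gcongr
        _ = _ := by ring
    have h1' : 0 < 1 - α := by linarith
    by_cases h : α ≤ 1 / 2
    · obtain ⟨D, hD, hle⟩ := exists_tripleCount_disjoint_mul_le h0 h
      refine ⟨4 * D, by positivity, fun n k hkn => ?_⟩
      have hnk : 2 * k ≤ n := by
        have : (2 * k : ℝ) ≤ n := by
          rw [hkn]; nlinarith [Nat.cast_nonneg (α := ℝ) n]
        exact_mod_cast this
      rw [gekrMu, if_pos h]
      exact bound _ _ _ _ _ _ _ (by positivity) (by positivity) le_rfl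
        (tripleCount_superset_le_disjoint hnk) (hle n k hkn)
    · obtain ⟨D, hD, hle⟩ := exists_tripleCount_superset_mul_le h0 h1
      refine ⟨4 * D, by positivity, fun n k hkn => ?_⟩
      have hnk : n ≤ 2 * k := by
        have : (n : ℝ) ≤ 2 * k := by
          rw [hkn]; nlinarith [Nat.cast_nonneg (α := ℝ) n]
        exact_mod_cast this
      rw [gekrMu, if_neg h]
      exact bound _ _ _ _ _ _ _ (by positivity) (by positivity)
        (tripleCount_disjoint_le_superset hnk) le_rfl (hle n k hkn)
  refine ⟨exp 1 ^ 4 * D, by positivity, fun n k hk hkn => ?_⟩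
  have hlow := one_le_mul_choose_sq h1 hk hkn
  set T : ℝ := ((tripleCount n k (fun j => (n - j).choose k) +
        3 * tripleCount n k (fun j => (n - j).choose (k - j)) : ℕ) : ℝ) with hT
  have hT0 : 0 ≤ T := Nat.cast_nonneg _
  calc T = T * 1 := (mul_one _).symm
    _ ≤ T * (exp 1 ^ 4 * n * ((n.choose k : ℝ) ^ 2 * (α ^ k * (1 - α) ^ (n - k)) ^ 2)) := by
        gcongr
    _ = exp 1 ^ 4 * (n.choose k : ℝ) ^ 2 * (T * (α ^ k * (1 - α) ^ (n - k)) ^ 2 * n) := by ring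
    _ ≤ exp 1 ^ 4 * (n.choose k : ℝ) ^ 2 * (D * gekrMu α ^ n) := by
        exact mul_le_mul_of_nonneg_left (hle n k hkn) (by positivity)
    _ = _ := by ring

theorem gekrNu_one_zero_sq {α : ℝ} (hμ : 0 < gekrMu α) {n : ℕ} (hn : 0 < n) :
    gekrNu 1 α 0 n ^ 2 * (gekrMu α ^ n * √n) = 1 := by
  have hn' : (0 : ℝ) < n := by exact_mod_cast hn
  have e1 : (gekrMu α ^ ((n : ℝ) / 2)) ^ 2 = gekrMu α ^ n := by
    rw [← Real.rpow_natCast, ← Real.rpow_mul hμ.le, Nat.cast_ofNat, div_mul_cancel₀ _ two_ne_zero,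
      Real.rpow_natCast]
  have e2 : ((n : ℝ) ^ ((1 : ℝ) / 4)) ^ 2 = √n := by
    rw [← Real.rpow_natCast, ← Real.rpow_mul hn'.le, Real.sqrt_eq_rpow]
    norm_num
  rw [gekrNu, add_zero, mul_one, Real.sqrt_one, one_mul, div_pow, mul_pow, e1, e2, one_pow]
  exact one_div_mul_cancel (by positivity)

theorem exists_array_of_card_le_two {n k m : ℕ} (hk : k ≤ n) (hm : m ≤ 2) :
    ∃ M : Fin m → Fin n → Fin 2, (∀ i, weight (M i) = k) ∧
      ∀ f : Fin 3 ↪o Fin m, ¬ IsDeficient M f := by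
  obtain ⟨A, -, hA⟩ := Finset.exists_subset_card_eq (s := (Finset.univ : Finset (Fin n))) (n := k)
    (by simpa using hk)
  refine ⟨fun _ j => if j ∈ A then 1 else 0, fun _ => ?_, fun f => ?_⟩
  · rw [weight, ← hA]
    congr 1
    ext j
    simp
  · have := Fintype.card_le_of_injective f f.injective
    simp only [Fintype.card_fin] at this
    omega

theorem theorem3 :
    ∃ K : ℝ, 0 < K ∧ ∀ α : ℚ, 0 < α → α < 1 →
      ∃ ε : ℕ → ℝ, Tendsto ε atTop (𝓝 0) ∧
        ∀ n k : ℕ, 0 < k → (k : ℚ) = α * n →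
          (∀ m : ℕ, (m : ℝ) ≤ gekrNu K α (ε n) n →
            0 < arrayLaw m n k {M | numDeficient M = 0}) ∧
          (∃ N : ℕ,
            IsGreatest {m : ℕ | ∃ M : Fin m → Fin n → Fin 2,
              (∀ i, weight (M i) = k) ∧ IsPartialCoveringArray 3 gekrTuples 1 M} N ∧
            gekrNu K α (ε n) n ≤ (N : ℝ)) := by
  refine ⟨1, one_pos, fun α h0 h1 => ?_⟩
  have h0' : (0 : ℝ) < α := by exact_mod_cast h0
  have h1' : (α : ℝ) < 1 := by exact_mod_cast h1
  obtain ⟨D, hD, hle⟩ := exists_deficient_count_le h0' h1'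
  have hμ := gekrMu_pos h0' h1'
  -- The value `-1` makes ν zero for the finitely many `n` at which `√n` does not yet absorb `D`.
  refine ⟨fun n => if 32 * D ≤ √(n : ℝ) then 0 else -1, ?_, fun n k hk hkn => ?_⟩
  · refine tendsto_const_nhds.congr' ?_
    have ht : Tendsto (fun n : ℕ => √(n : ℝ)) atTop atTop :=
      Real.tendsto_sqrt_atTop.comp tendsto_natCast_atTop_atTop
    filter_upwards [ht.eventually_ge_atTop (32 * D)] with n hn
    rw [if_pos hn]
  have hkn' : (k : ℝ) = α * n := by exact_mod_cast hkn
  have hkle : k ≤ n := by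
    have : (k : ℝ) ≤ n := by rw [hkn']; nlinarith [Nat.cast_nonneg (α := ℝ) n]
    exact_mod_cast this
  obtain ⟨ν, hν⟩ : ∃ ν, gekrNu 1 α (if 32 * D ≤ √(n : ℝ) then 0 else -1) n = ν := ⟨_, rfl⟩
  have hν0 : 0 ≤ ν := by
    rw [← hν, gekrNu]
    refine mul_nonneg (by positivity) ?_
    split_ifs <;> norm_num
  -- The extra 1 admits `⌈ν⌉₊`, as required by (ii).
  have hex : ∀ m : ℕ, (m : ℝ) < ν + 1 → ∃ M : Fin m → Fin n → Fin 2, (∀ i, weight (M i) = k) ∧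
      ∀ f : Fin 3 ↪o Fin m, ¬ IsDeficient M f := by
    intro m hm
    by_cases hm2 : m ≤ 2
    · exact exists_array_of_card_le_two hkle hm2
    have hm3 : (3 : ℝ) ≤ m := by exact_mod_cast (by omega : 3 ≤ m)
    have hD32 : 32 * D ≤ √(n : ℝ) := by
      by_contra h
      rw [if_neg h, gekrNu] at hν
      norm_num at hν
      linarith
    rw [if_pos hD32] at hν
    have hsq := gekrNu_one_zero_sq hμ (hk.trans_le hkle)
    rw [hν] at hsq
    refine exists_array_of_card_le hkle ?_
    have key := hle n k hk hkn'
    set T := tripleCount n k (fun j => (n - j).choose k) +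
      3 * tripleCount n k (fun j => (n - j).choose (k - j)) with hT
    have hreal : 8 * (m : ℝ) ^ 2 * T ≤ (n.choose k : ℝ) ^ 2 := by
      -- From `3 ≤ m < ν + 1` follows `m ≤ 2 * ν`; hence `32 = 8 * 2 ^ 2`.
      calc 8 * (m : ℝ) ^ 2 * T
          ≤ 8 * (2 * ν) ^ 2 * (D * gekrMu α ^ n * (n.choose k : ℝ) ^ 2) := by
            gcongr
            linarith
        _ = ν ^ 2 * (gekrMu α ^ n * (32 * D)) * (n.choose k : ℝ) ^ 2 := by ring
        _ ≤ ν ^ 2 * (gekrMu α ^ n * √n) * (n.choose k : ℝ) ^ 2 := by gcongr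
        _ = _ := by rw [hsq, one_mul]
    exact_mod_cast hreal
  simp only [hν]
  refine ⟨fun m hm => ?_, ?_⟩
  · obtain ⟨M, hM, hdef⟩ := hex m (by linarith)
    exact arrayLaw_pos hM _ (numDeficient_eq_zero_iff.2 hdef)
  · set S := {m : ℕ | ∃ M : Fin m → Fin n → Fin 2,
      (∀ i, weight (M i) = k) ∧ IsPartialCoveringArray 3 gekrTuples 1 M} with hS
    have hbdd : BddAbove S :=
      ⟨2 ^ n + 2, fun m ⟨M, _, hM⟩ => isPartialCoveringArray_card_le hM⟩
    have hmem : ⌈ν⌉₊ ∈ S := by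
      obtain ⟨M, hM, hdef⟩ := hex ⌈ν⌉₊ (Nat.ceil_lt_add_one hν0)
      exact ⟨M, hM, isPartialCoveringArray_of_not_isDeficient hdef⟩
    exact ⟨sSup S, ⟨Nat.sSup_mem ⟨_, hmem⟩ hbdd, fun m hm => le_csSup hbdd hm⟩,
      (Nat.le_ceil ν).trans (by exact_mod_cast le_csSup hbdd hmem)⟩

end Main
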